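/- Let $n\ge 3$, and let $\mathcal{DC}_n$ be the double Catalan monoid, i.e. the submonoid of the monoid $B_n$ of binary relations on $\{1,\dots,n\}$ generated by the relations $\varepsilon_i=\mathrm{id}\cup\{(i,i+1),(i+1,i)\}$, $1\le i\le n-1$. Let $\mathcal H_n$ be the $0$-Hecke monoid of $S_n$, generated by $e_1,\dots,e_{n-1}$ subject to $e_i^2=e_i$, $e_ie_j=e_je_i$ for $|i-j|\neq 1$, and $e_ie_{i+1}e_i=e_{i+1}e_ie_{i+1}$. For a set $J$ of simple transpositions $s_i=(i,i+1)$ let $e_J=e_{i_1}\cdots e_{i_k}\in\mathcal H_n$, where $s_{i_1}\cdots s_{i_k}$ is a reduced decomposition of the longest element of the subgroup of $S_n$ generated by $J$; write $(s)=\{s_1,\dots,s_{n-1}\}\setminus\{s\}$ and $e_0=e_{\{s_1,\dots,s_{n-1}\}}$. For a field $\Bbbk$ put $P'_{(s)}=\Bbbk\mathcal H_n(e_{(s)}-e_0)$ and $P=P'_{(s_1)}\oplus P'_{(s_{n-1})}$. A representation of a monoid is called effective if it is injective, and an effective module is called minimal if no proper submodule of it is effective. Theorem. Let $\Bbbk$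 be any field. The minimal dimension of an effective linear representation of $\mathcal{DC}_n$ over $\Bbbk$ is $2n-2$. The action of $\mathcal H_n$ on $P$ factors through the surjection $\mathcal H_n\to\mathcal{DC}_n$, $e_i\mapsto\varepsilon_i$, and the resulting $\mathcal{DC}_n$-module $P$ has dimension $2n-2$, is minimal effective, and is isomorphic to a submodule of every effective $\mathcal{DC}_n$-module over $\Bbbk$. Up to isomorphism $P$ is the unique minimal effective $\mathcal{DC}_n$-module, and also the unique effective $\mathcal{DC}_n$-module that embeds in every effective $\mathcal{DC}_n$-module. -/

import Mathlib

universe u v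

namespace DoubleCatalan

/-! ### Binary relations and the double Catalan monoid -/

/-- The set `B_n` of all binary relations on an `n`-element chain (equivalently, of all Boolean
`n × n` matrices). -/
def BinRel (n : ℕ) : Type := SetRel (Fin n) (Fin n)

/-- `B_n` is a monoid under composition of relations, i.e. multiplication of Boolean matrices:
`(i, j) ∈ ξ * η` iff there is some `t` with `(i, t) ∈ ξ` and `(t, j) ∈ η`. -/
instance (n : ℕ) : Monoid (BinRel n) where
  mul ξ η := SetRel.comp ξ η
  one := SetRel.id
  mul_assoc := SetRel.comp_assoc
  one_mul := SetRel.id_comp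
  mul_one := SetRel.comp_id

/-- The simple transposition `s_{i+1} = (i+1, i+2)` of `S_n` (the indices `i` and the points
being permuted are numbered from `0` here). -/
def simpleRefl {n : ℕ} (i : Fin (n - 1)) : Equiv.Perm (Fin n) :=
  Equiv.swap ⟨i, by omega⟩ ⟨i + 1, by omega⟩

/-- The usual embedding of `S_n` into `B_n`. -/
def permRel {n : ℕ} (w : Equiv.Perm (Fin n)) : BinRel n :=
  {p : Fin n × Fin n | p.1 = w p.2}

/-- The relation `ε_i`, the Boolean sum (union) of the identity and of the relation of `s_i`. -/
def epsRel {n : ℕ} (i : Fin (n - 1)) : BinRel n :=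
  (permRel 1 ∪ permRel (simpleRefl i) : Set (Fin n × Fin n))

/-- The double Catalan monoid: the submonoid of `B_n` generated by all `ε_i`. -/
def DC (n : ℕ) : Submonoid (BinRel n) :=
  Submonoid.closure (Set.range epsRel)

/-- `ε_i` as an element of the double Catalan monoid. -/
def eps {n : ℕ} (i : Fin (n - 1)) : DC n :=
  ⟨epsRel i, Submonoid.subset_closure (Set.mem_range_self i)⟩

/-! ### The `0`-Hecke monoid of the symmetric group -/

/-- The defining relations of the `0`-Hecke monoid of `S_n`. -/
inductive HeckeRel (n : ℕ) : FreeMonoid (Fin (n - 1)) → FreeMonoid (Fin (n - 1)) → Prop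
  | idem (i : Fin (n - 1)) : HeckeRel n (.of i * .of i) (.of i)
  | comm (i j : Fin (n - 1)) (hij : (i : ℕ) ≠ j + 1) (hji : (j : ℕ) ≠ i + 1) :
      HeckeRel n (.of i * .of j) (.of j * .of i)
  | braid (i j : Fin (n - 1)) (hij : (j : ℕ) = i + 1) :
      HeckeRel n (.of i * .of j * .of i) (.of j * .of i * .of j)

/-- The `0`-Hecke monoid `H_n` of `S_n`. -/
abbrev Hecke (n : ℕ) : Type := PresentedMonoid (HeckeRel n)

/-- The generator `e_i` of `H_n`. -/
def gen {n : ℕ} (i : Fin (n - 1)) : Hecke n := PresentedMonoid.of (HeckeRel n) i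

/-- The permutation `s_{i_1} ⋯ s_{i_k}` spelled by the word `i_1 ⋯ i_k`. -/
def wordPerm {n : ℕ} (l : List (Fin (n - 1))) : Equiv.Perm (Fin n) :=
  (l.map simpleRefl).prod

/-- `l` is a reduced decomposition of `w`. -/
def IsReducedWord {n : ℕ} (w : Equiv.Perm (Fin n)) (l : List (Fin (n - 1))) : Prop :=
  wordPerm l = w ∧ ∀ l', wordPerm l' = w → l.length ≤ l'.length

theorem exists_wordPerm {n : ℕ} (w : Equiv.Perm (Fin n)) :
    ∃ l : List (Fin (n - 1)), wordPerm l = w := by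
  cases n with
  | zero => exact ⟨[], Subsingleton.elim _ _⟩
  | succ m =>
    have hw : w ∈ Submonoid.closure
        (Set.range fun i : Fin m ↦ Equiv.swap i.castSucc i.succ) := by
      rw [Equiv.Perm.mclosure_swap_castSucc_succ]; trivial
    obtain ⟨l, hl, rfl⟩ := Submonoid.exists_list_of_mem_closure hw
    clear hw
    induction l with
    | nil => exact ⟨[], rfl⟩
    | cons a l ih =>
      obtain ⟨l', hl'⟩ := ih fun y hy ↦ hl y (List.mem_cons_of_mem _ hy)
      obtain ⟨i, rfl⟩ := hl a List.mem_cons_self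
      refine ⟨i :: l', ?_⟩
      rw [List.prod_cons, ← hl']
      rfl

theorem exists_isReducedWord {n : ℕ} (w : Equiv.Perm (Fin n)) :
    ∃ l : List (Fin (n - 1)), IsReducedWord w l := by
  obtain ⟨l, hl, hmin⟩ := WellFounded.has_min (measure List.length).wf
    {l : List (Fin (n - 1)) | wordPerm l = w} (exists_wordPerm w)
  exact ⟨l, hl, fun l' hl' ↦ not_lt.mp (hmin l' hl')⟩

/-- A reduced decomposition of `w`. -/
noncomputable def reducedWord {n : ℕ} (w : Equiv.Perm (Fin n)) : List (Fin (n - 1)) :=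
  Classical.choose (exists_isReducedWord w)

/-- The Coxeter length of `w`. -/
noncomputable def len {n : ℕ} (w : Equiv.Perm (Fin n)) : ℕ := (reducedWord w).length

/-- The element `z_w = e_{i_1} ⋯ e_{i_k}` of `H_n`, where `i_1 ⋯ i_k` is a reduced decomposition
of `w` (the element does not depend on which one). -/
noncomputable def z {n : ℕ} (w : Equiv.Perm (Fin n)) : Hecke n :=
  ((reducedWord w).map gen).prod

/-- The parabolic subgroup `W_J` of `S_n` generated by the `s_j` with `j ∈ J`. -/
def parabolic {n : ℕ} (J : Set (Fin (n - 1))) : Subgroup (Equiv.Perm (Fin n)) :=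
  Subgroup.closure (simpleRefl '' J)

theorem exists_longest {n : ℕ} (J : Set (Fin (n - 1))) :
    ∃ w ∈ parabolic J, ∀ u ∈ parabolic J, len u ≤ len w :=
  Set.exists_max_image (parabolic J : Set (Equiv.Perm (Fin n))) len (Set.toFinite _)
    ⟨1, one_mem _⟩

/-- The longest element `w_J` of the parabolic subgroup `W_J`. -/
noncomputable def longest {n : ℕ} (J : Set (Fin (n - 1))) : Equiv.Perm (Fin n) :=
  Classical.choose (exists_longest J)

/-- The idempotent `e_J = z_{w_J}` of `H_n`. -/
noncomputable def idem {n : ℕ} (J : Set (Fin (n - 1))) : Hecke n := z (longest J)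

/-! ### The modules -/

/-- The left ideal `P'_{(s)} = k H_n (e_{(s)} - e_0)` of the monoid algebra `k H_n`, where `(s)` is
the set of all simple reflections other than `s = s_i`, and `e_0` is the idempotent belonging to
the set of all simple reflections. -/
noncomputable def P' (k : Type*) [Field k] {n : ℕ} (i : Fin (n - 1)) :
    Ideal (MonoidAlgebra k (Hecke n)) :=
  Ideal.span {MonoidAlgebra.of k (Hecke n) (idem {i}ᶜ) -
    MonoidAlgebra.of k (Hecke n) (idem Set.univ)}

/-- The `k H_n`-module `P = P'_{(s_1)} ⊕ P'_{(s_{n-1})}`. -/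
abbrev P (k : Type*) [Field k] (n : ℕ) (hn : 3 ≤ n) : Type _ :=
  P' k (⟨0, by omega⟩ : Fin (n - 1)) × P' k (⟨n - 2, by omega⟩ : Fin (n - 1))

/-! ### Effective representations -/

section Effective

variable {k M V V' : Type*} [Field k] [Monoid M] [AddCommGroup V] [Module k V]
  [AddCommGroup V'] [Module k V']

/-- A representation of a monoid is effective if distinct elements of the monoid act
differently. -/
def IsEffective (ρ : Representation k M V) : Prop := Function.Injective ρ

/-- `ρ` is isomorphic to a subrepresentation of `σ`. -/
def EmbedsIn (ρ : Representation k M V) (σ : Representation k M V') : Prop :=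
  ∃ f : ρ.IntertwiningMap σ, Function.Injective f

/-- An effective representation is minimal if none of its proper subrepresentations is
effective. -/
def IsMinimalEffective (ρ : Representation k M V) : Prop :=
  IsEffective ρ ∧ ∀ U : Subrepresentation ρ, IsEffective U.toRepresentation → U = ⊤

end Effective

end DoubleCatalan

/-!
A product `ε_{i_1} ⋯ ε_{i_k}` relates a point `b` exactly to the points of an interval
(`relates_toDC_iff`). Its upper end is the image of `b` under the action of the `0`-Hecke monoid on
the chain with `e_i : i ↦ i + 1`, its lower end the image under the action with `e_i : i + 1 ↦ i`.
So two elements of `H_n` agree in `DC_n` if and only if they agree in both actions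
(`toDC_eq_toDC_iff`).

These two actions are visible in `P`. By Matsumoto's theorem (`prod_gen_eq_of_isReducedWord`) the
idempotent `e_J` absorbs the generators from `J` on the left, and `e_0` is the zero of `H_n`. From
this and the defining relations, the left ideal `H_n e_{(s)}` for the first simple reflection `s` is
a chain of `n` elements ending in `e_0`, on which `H_n` acts as in the upward action
(`mul_upChain`); for the last simple reflection one gets the downward action (`mul_downChain`).
Hence the differences of the other elements of the chains and `e_0` span `P`, and the action of
`H_n` on `P` factors through an injective action of `DC_n` (`heckeRep_eq_iff`).

Each summand of `P` has a one-dimensional socle, spanned by the last nonzero vector of its chain,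
and for `n ≥ 3` the two socles are not isomorphic. So a map from `P` is injective as soon as it kills
neither socle; `linearIndependent_chains` is the elementary form of this statement, and it also
gives `dim P = 2n - 2`. On an effective module `V` the elements of the two chains just before `e_0`
act differently from `e_0`, say on vectors `v₁` and `v₂`, and then `(y₁, y₂) ↦ y₁ v₁ + y₂ v₂` embeds
`P` into `V` (`embedsIn_of_isEffective`). All claims about minimality and uniqueness follow by
comparing dimensions.
-/

namespace DoubleCatalan

/-! ### Inversions and reduced words -/

/-- The number of inversions of `w⁻¹`, which is the Coxeter length of `w`. -/
def invNum {n : ℕ} (w : Equiv.Perm (Fin n)) : ℕ :=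
  (Finset.univ.filter fun p : Fin n × Fin n ↦ p.1 < p.2 ∧ w⁻¹ p.2 < w⁻¹ p.1).card

/-- The simple reflection `s_i` is a left descent of `w`, expressed as: `w⁻¹` inverts `i` and
`i + 1`. -/
def IsDescent {n : ℕ} (w : Equiv.Perm (Fin n)) (i : Fin (n - 1)) : Prop :=
  w⁻¹ ⟨i + 1, by omega⟩ < w⁻¹ ⟨i, by omega⟩

theorem simpleRefl_apply {n : ℕ} (i : Fin (n - 1)) (a : Fin n) :
    (simpleRefl i a : ℕ) =
      if (a : ℕ) = i then (i : ℕ) + 1 else if (a : ℕ) = i + 1 then i else a := by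
  unfold simpleRefl
  rw [Equiv.swap_apply_def]
  simp only [Fin.ext_iff]
  split_ifs <;> rfl

theorem simpleRefl_mul_self {n : ℕ} (i : Fin (n - 1)) : simpleRefl i * simpleRefl i = 1 :=
  Equiv.swap_mul_self _ _

theorem simpleRefl_inv {n : ℕ} (i : Fin (n - 1)) : (simpleRefl i)⁻¹ = simpleRefl i :=
  Equiv.swap_inv _ _

theorem simpleRefl_mul_cancel {n : ℕ} (i : Fin (n - 1)) (w : Equiv.Perm (Fin n)) :
    simpleRefl i * (simpleRefl i * w) = w := by
  rw [← mul_assoc, simpleRefl_mul_self, one_mul]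

theorem simpleRefl_mul_comm {n : ℕ} {i j : Fin (n - 1)} (hij : (i : ℕ) ≠ j + 1)
    (hji : (j : ℕ) ≠ i + 1) : simpleRefl i * simpleRefl j = simpleRefl j * simpleRefl i := by
  ext a
  simp only [Equiv.Perm.mul_apply, simpleRefl_apply]
  split_ifs <;> omega

theorem simpleRefl_braid {n : ℕ} {i j : Fin (n - 1)} (h : (j : ℕ) = i + 1) :
    simpleRefl i * simpleRefl j * simpleRefl i = simpleRefl j * simpleRefl i * simpleRefl j := by
  ext a
  simp only [Equiv.Perm.mul_apply, simpleRefl_apply, h]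
  have h' : (i : ℕ) + 1 + 1 ≠ i := by omega
  by_cases h0 : (a : ℕ) = i
  · simp [h0, h', h'.symm]
  by_cases h1 : (a : ℕ) = i + 1
  · simp [h1, h', h'.symm]
  by_cases h2 : (a : ℕ) = i + 1 + 1
  · simp [h2, h', h'.symm]
  simp [h0, h1, h2]

theorem mul_inv_apply_simpleRefl {n : ℕ} (i : Fin (n - 1)) (w : Equiv.Perm (Fin n)) (a : Fin n) :
    (simpleRefl i * w)⁻¹ a = w⁻¹ (simpleRefl i a) := by
  rw [mul_inv_rev, simpleRefl_inv, Equiv.Perm.mul_apply]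

theorem simpleRefl_left {n : ℕ} (i : Fin (n - 1)) :
    simpleRefl i (⟨i, by omega⟩ : Fin n) = ⟨i + 1, by omega⟩ := Equiv.swap_apply_left _ _

theorem simpleRefl_right {n : ℕ} (i : Fin (n - 1)) :
    simpleRefl i (⟨i + 1, by omega⟩ : Fin n) = ⟨i, by omega⟩ := Equiv.swap_apply_right _ _

theorem simpleRefl_of_ne {n : ℕ} (i : Fin (n - 1)) (a : Fin n) (h : (a : ℕ) ≠ i)
    (h' : (a : ℕ) ≠ i + 1) : simpleRefl i a = a := by
  ext
  rw [simpleRefl_apply, if_neg h, if_neg h']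

theorem isDescent_simpleRefl_mul {n : ℕ} {i : Fin (n - 1)} {w : Equiv.Perm (Fin n)} :
    IsDescent (simpleRefl i * w) i ↔ ¬ IsDescent w i := by
  unfold IsDescent
  rw [mul_inv_apply_simpleRefl, mul_inv_apply_simpleRefl, simpleRefl_left, simpleRefl_right,
    ← not_le, not_iff_not]
  refine ⟨fun h ↦ lt_of_le_of_ne h fun h' ↦ ?_, le_of_lt⟩
  simpa using congrArg Fin.val (w⁻¹.injective h')

theorem invNum_simpleRefl_mul_of_not_isDescent {n : ℕ} {i : Fin (n - 1)} {w : Equiv.Perm (Fin n)}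
    (h : ¬ IsDescent w i) : invNum (simpleRefl i * w) = invNum w + 1 := by
  have hd := isDescent_simpleRefl_mul.2 h
  unfold IsDescent at h hd
  simp only [mul_inv_apply_simpleRefl, simpleRefl_left, simpleRefl_right] at hd
  have hlt : (⟨i, by omega⟩ : Fin n) < ⟨i + 1, by omega⟩ := Nat.lt_succ_self _
  have hs : (simpleRefl i).symm = simpleRefl i := simpleRefl_inv i
  have hss : ∀ a, simpleRefl i (simpleRefl i a) = a := Equiv.swap_apply_self _ _
  -- apart from `(i, i + 1)`, the inversions are permuted by `s_i`
  have key : (Finset.univ.filter fun p : Fin n × Fin n ↦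
        p.1 < p.2 ∧ (simpleRefl i * w)⁻¹ p.2 < (simpleRefl i * w)⁻¹ p.1) =
      insert (⟨i, by omega⟩, ⟨i + 1, by omega⟩)
        ((Finset.univ.filter fun p : Fin n × Fin n ↦ p.1 < p.2 ∧ w⁻¹ p.2 < w⁻¹ p.1).map
          ((simpleRefl i).prodCongr (simpleRefl i)).toEmbedding) := by
    ext ⟨a, b⟩
    simp only [Finset.mem_filter, Finset.mem_univ, true_and, Finset.mem_insert, Prod.mk.injEq,
      Finset.mem_map_equiv, Equiv.prodCongr_symm, Equiv.prodCongr_apply, Prod.map,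
      mul_inv_apply_simpleRefl, hs]
    by_cases hab : a = ⟨i, by omega⟩ ∧ b = ⟨i + 1, by omega⟩
    · obtain ⟨rfl, rfl⟩ := hab
      rw [simpleRefl_left, simpleRefl_right]
      exact iff_of_true ⟨hlt, hd⟩ (Or.inl ⟨rfl, rfl⟩)
    · by_cases hba : a = ⟨i + 1, by omega⟩ ∧ b = ⟨i, by omega⟩
      · obtain ⟨rfl, rfl⟩ := hba
        rw [simpleRefl_left, simpleRefl_right]
        exact iff_of_false (fun h' ↦ lt_asymm hlt h'.1)
          (fun h' ↦ h'.elim (fun h'' ↦ hab h'') fun h'' ↦ h h''.2)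
      · have : a < b ↔ simpleRefl i a < simpleRefl i b := by
          simp only [Fin.ext_iff] at hab hba
          simp only [Fin.lt_def, simpleRefl_apply]
          split_ifs <;> omega
        rw [this]
        simp only [hab, false_or]
  unfold invNum
  rw [key, Finset.card_insert_of_notMem, Finset.card_map]
  simp only [Finset.mem_map_equiv, Equiv.prodCongr_symm, Equiv.prodCongr_apply, Prod.map,
    Finset.mem_filter, hs, simpleRefl_left, simpleRefl_right]
  exact fun h' ↦ lt_asymm hlt h'.2.1

theorem invNum_simpleRefl_mul_of_isDescent {n : ℕ} {i : Fin (n - 1)} {w : Equiv.Perm (Fin n)}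
    (h : IsDescent w i) : invNum w = invNum (simpleRefl i * w) + 1 := by
  rw [← invNum_simpleRefl_mul_of_not_isDescent fun h' ↦ isDescent_simpleRefl_mul.1 h' h,
    simpleRefl_mul_cancel]

theorem invNum_one {n : ℕ} : invNum (1 : Equiv.Perm (Fin n)) = 0 := by
  rw [invNum, Finset.card_eq_zero, Finset.filter_eq_empty_iff]
  rintro ⟨a, b⟩ - ⟨h, h'⟩
  simp only [inv_one, Equiv.Perm.coe_one, id_eq] at h'
  exact lt_asymm h h'

theorem wordPerm_cons {n : ℕ} (i : Fin (n - 1)) (l : List (Fin (n - 1))) :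
    wordPerm (i :: l) = simpleRefl i * wordPerm l := by
  simp [wordPerm]

theorem invNum_wordPerm_le {n : ℕ} (l : List (Fin (n - 1))) :
    invNum (wordPerm l) ≤ l.length := by
  induction l with
  | nil => exact invNum_one.le
  | cons i l ih =>
    rw [wordPerm_cons, List.length_cons]
    by_cases h : IsDescent (wordPerm l) i
    · have := invNum_simpleRefl_mul_of_isDescent h
      omega
    · have := invNum_simpleRefl_mul_of_not_isDescent h
      omega

theorem exists_isDescent {n : ℕ} {w : Equiv.Perm (Fin n)} (hw : w ≠ 1) :
    ∃ i, IsDescent w i := by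
  by_contra! h
  apply hw
  obtain _ | m := n
  · exact Subsingleton.elim _ _
  have hmono : StrictMono (w⁻¹ : Equiv.Perm (Fin (m + 1))) := by
    rw [Fin.strictMono_iff_lt_succ]
    intro i
    refine lt_of_le_of_ne (not_lt.1 (h i)) fun h' ↦ ?_
    simpa [Fin.ext_iff] using w⁻¹.injective h'
  have h1 : w⁻¹ = 1 := by
    ext a
    have := congrArg (fun f : Fin (m + 1) ≃o Fin (m + 1) ↦ f a)
      (Subsingleton.elim (StrictMono.orderIsoOfSurjective _ hmono w⁻¹.surjective)
        (OrderIso.refl _))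
    exact congrArg Fin.val this
  simpa using h1

theorem exists_wordPerm_length_eq {n : ℕ} (w : Equiv.Perm (Fin n)) :
    ∃ l : List (Fin (n - 1)), wordPerm l = w ∧ l.length = invNum w := by
  induction hN : invNum w generalizing w with
  | zero =>
    refine ⟨[], ?_, rfl⟩
    by_contra hw
    obtain ⟨i, hi⟩ := exists_isDescent (w := w) (Ne.symm hw)
    have := invNum_simpleRefl_mul_of_isDescent hi
    omega
  | succ N ih =>
    have hw : w ≠ 1 := by
      rintro rfl
      rw [invNum_one] at hN
      omega
    obtain ⟨i, hi⟩ := exists_isDescent hw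
    have := invNum_simpleRefl_mul_of_isDescent hi
    obtain ⟨l, hl, hlen⟩ := ih (simpleRefl i * w) (by omega)
    exact ⟨i :: l, by rw [wordPerm_cons, hl, simpleRefl_mul_cancel], by simp [hlen]⟩

theorem isReducedWord_iff {n : ℕ} {w : Equiv.Perm (Fin n)} {l : List (Fin (n - 1))} :
    IsReducedWord w l ↔ wordPerm l = w ∧ l.length = invNum w := by
  refine ⟨fun ⟨h, h'⟩ ↦ ⟨h, ?_⟩, fun ⟨h, h'⟩ ↦ ⟨h, fun l' hl' ↦ ?_⟩⟩
  · obtain ⟨l', hl', hlen⟩ := exists_wordPerm_length_eq w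
    refine le_antisymm (hlen ▸ h' l' hl') ?_
    rw [← h]
    exact invNum_wordPerm_le l
  · rw [h', ← hl']
    exact invNum_wordPerm_le l'

theorem isReducedWord_reducedWord {n : ℕ} (w : Equiv.Perm (Fin n)) :
    IsReducedWord w (reducedWord w) := Classical.choose_spec (exists_isReducedWord w)

theorem len_eq_invNum {n : ℕ} (w : Equiv.Perm (Fin n)) : len w = invNum w :=
  (isReducedWord_iff.1 (isReducedWord_reducedWord w)).2

theorem isReducedWord_cons {n : ℕ} {w : Equiv.Perm (Fin n)} {i : Fin (n - 1)}
    {l : List (Fin (n - 1))} :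
    IsReducedWord w (i :: l) ↔ IsDescent w i ∧ IsReducedWord (simpleRefl i * w) l := by
  simp only [isReducedWord_iff, wordPerm_cons, List.length_cons]
  constructor
  · rintro ⟨rfl, h⟩
    have h1 := invNum_wordPerm_le l
    rw [isDescent_simpleRefl_mul, simpleRefl_mul_cancel]
    by_cases hd : IsDescent (wordPerm l) i
    · have := invNum_simpleRefl_mul_of_isDescent hd
      omega
    · have := invNum_simpleRefl_mul_of_not_isDescent hd
      exact ⟨hd, rfl, by omega⟩
  · rintro ⟨hd, h, h'⟩
    have := invNum_simpleRefl_mul_of_isDescent hd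
    exact ⟨by rw [h, simpleRefl_mul_cancel], by omega⟩

theorem isDescent_simpleRefl_mul_of_comm {n : ℕ} {i j : Fin (n - 1)} {w : Equiv.Perm (Fin n)}
    (h : i ≠ j) (hij : (i : ℕ) ≠ j + 1) (hji : (j : ℕ) ≠ i + 1) (hj : IsDescent w j) :
    IsDescent (simpleRefl i * w) j := by
  have : (i : ℕ) ≠ j := fun h' ↦ h (Fin.ext h')
  unfold IsDescent
  rw [mul_inv_apply_simpleRefl, mul_inv_apply_simpleRefl, simpleRefl_of_ne, simpleRefl_of_ne]
  · exact hj
  all_goals simp only; omega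

/-! ### Words in the `0`-Hecke monoid -/

theorem gen_mul_self {n : ℕ} (i : Fin (n - 1)) : gen i * gen i = gen i :=
  PresentedMonoid.mk_eq_mk_of_rel (HeckeRel.idem i)

theorem gen_mul_comm {n : ℕ} {i j : Fin (n - 1)} (hij : (i : ℕ) ≠ j + 1)
    (hji : (j : ℕ) ≠ i + 1) : gen i * gen j = gen j * gen i :=
  PresentedMonoid.mk_eq_mk_of_rel (HeckeRel.comm i j hij hji)

theorem gen_braid {n : ℕ} {i j : Fin (n - 1)} (h : (j : ℕ) = i + 1) :
    gen i * gen j * gen i = gen j * gen i * gen j :=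
  PresentedMonoid.mk_eq_mk_of_rel (HeckeRel.braid i j h)

/-- Matsumoto's theorem for words beginning with `s_i` and `s_{i+1}`, given the theorem for shorter
words. -/
theorem prod_gen_cons_eq_of_adjacent {n : ℕ} {i j : Fin (n - 1)} (hij : (j : ℕ) = i + 1)
    {w : Equiv.Perm (Fin n)} {l₁ l₂ : List (Fin (n - 1))}
    (h₁ : IsReducedWord w (i :: l₁)) (h₂ : IsReducedWord w (j :: l₂))
    (ih₁ : ∀ l, IsReducedWord (simpleRefl i * w) l → (l₁.map gen).prod = (l.map gen).prod)
    (ih₂ : ∀ l, IsReducedWord (simpleRefl j * w) l → (l₂.map gen).prod = (l.map gen).prod) :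
    ((i :: l₁).map gen).prod = ((j :: l₂).map gen).prod := by
  rw [isReducedWord_cons] at h₁ h₂
  obtain ⟨hi, h₁⟩ := h₁
  obtain ⟨hj, h₂⟩ := h₂
  obtain ⟨l, hl⟩ := exists_isReducedWord (simpleRefl i * (simpleRefl j * (simpleRefl i * w)))
  have hb : simpleRefl j * (simpleRefl i * (simpleRefl j * w)) =
      simpleRefl i * (simpleRefl j * (simpleRefl i * w)) := by
    simp only [← mul_assoc]
    rw [simpleRefl_braid hij]
  have ei : (⟨i + 1, by omega⟩ : Fin n) = ⟨j, by omega⟩ := Fin.ext hij.symm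
  unfold IsDescent at hi hj
  rw [ei] at hi
  have e1 : simpleRefl i (⟨j + 1, by omega⟩ : Fin n) = ⟨j + 1, by omega⟩ :=
    simpleRefl_of_ne _ _ (by simp only; omega) (by simp only; omega)
  have e2 : simpleRefl i (⟨j, by omega⟩ : Fin n) = ⟨i, by omega⟩ := by
    rw [← ei, simpleRefl_right]
  have e3 : simpleRefl i (⟨i, by omega⟩ : Fin n) = ⟨j, by omega⟩ := by
    rw [simpleRefl_left, ei]
  have e4 : simpleRefl j (⟨i, by omega⟩ : Fin n) = ⟨i, by omega⟩ :=
    simpleRefl_of_ne _ _ (by simp only; omega) (by simp only; omega)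
  have e5 := simpleRefl_left j
  have e6 := simpleRefl_right j
  have r₁ : IsReducedWord (simpleRefl i * w) (j :: i :: l) := by
    rw [isReducedWord_cons, isReducedWord_cons]
    refine ⟨?_, ?_, hl⟩
    · unfold IsDescent
      simp only [mul_inv_apply_simpleRefl, e1, e2]
      exact hj.trans hi
    · unfold IsDescent
      simp only [mul_inv_apply_simpleRefl, ei, e1, e3, e4, e5]
      exact hj
  have r₂ : IsReducedWord (simpleRefl j * w) (i :: j :: l) := by
    rw [isReducedWord_cons, isReducedWord_cons]
    refine ⟨?_, ?_, hb ▸ hl⟩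
    · unfold IsDescent
      simp only [mul_inv_apply_simpleRefl, ei, e4, e5]
      exact hj.trans hi
    · unfold IsDescent
      simp only [mul_inv_apply_simpleRefl, e1, e2, e4, e6]
      exact hi
  rw [List.map_cons, List.map_cons, List.prod_cons, List.prod_cons, ih₁ _ r₁, ih₂ _ r₂]
  simp only [List.map_cons, List.prod_cons, ← mul_assoc]
  rw [gen_braid hij]

/-- Matsumoto's theorem: the element of the `0`-Hecke monoid spelled by a reduced word depends only
on the permutation. -/
theorem prod_gen_eq_of_isReducedWord {n : ℕ} {w : Equiv.Perm (Fin n)} {l l' : List (Fin (n - 1))}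
    (h : IsReducedWord w l) (h' : IsReducedWord w l') :
    (l.map gen).prod = (l'.map gen).prod := by
  induction hN : l.length generalizing w l l' with
  | zero =>
    have hlen : l.length = l'.length := by
      rw [(isReducedWord_iff.1 h).2, (isReducedWord_iff.1 h').2]
    rw [List.length_eq_zero_iff.1 hN, List.length_eq_zero_iff.1 (hlen.symm.trans hN)]
  | succ N ih =>
    have hlen : l.length = l'.length := by
      rw [(isReducedWord_iff.1 h).2, (isReducedWord_iff.1 h').2]
    obtain _ | ⟨i, l₁⟩ := l
    · simp at hN
    obtain _ | ⟨j, l₂⟩ := l'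
    · simp at hlen
    simp only [List.length_cons, Nat.add_right_cancel_iff] at hN hlen
    have h₁ := isReducedWord_cons.1 h
    have h₂ := isReducedWord_cons.1 h'
    have ih₁ : ∀ l, IsReducedWord (simpleRefl i * w) l →
        (l₁.map gen).prod = (l.map gen).prod := fun l hl ↦ ih h₁.2 hl hN
    have ih₂ : ∀ l, IsReducedWord (simpleRefl j * w) l →
        (l₂.map gen).prod = (l.map gen).prod := fun l hl ↦ ih h₂.2 hl (by omega)
    by_cases hij : i = j
    · subst hij
      rw [List.map_cons, List.map_cons, List.prod_cons, List.prod_cons, ih₁ _ h₂.2]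
    by_cases hj : (j : ℕ) = i + 1
    · exact prod_gen_cons_eq_of_adjacent hj h h' ih₁ ih₂
    by_cases hi : (i : ℕ) = j + 1
    · exact (prod_gen_cons_eq_of_adjacent hi h' h ih₂ ih₁).symm
    obtain ⟨l, hl⟩ := exists_isReducedWord (simpleRefl j * (simpleRefl i * w))
    have hc : simpleRefl j * (simpleRefl i * w) = simpleRefl i * (simpleRefl j * w) := by
      rw [← mul_assoc, ← mul_assoc, simpleRefl_mul_comm hi hj]
    rw [List.map_cons, List.map_cons, List.prod_cons, List.prod_cons,
      ih₁ (j :: l) (isReducedWord_cons.2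
        ⟨isDescent_simpleRefl_mul_of_comm hij hi hj h₂.1, hl⟩),
      ih₂ (i :: l) (isReducedWord_cons.2
        ⟨isDescent_simpleRefl_mul_of_comm (Ne.symm hij) hj hi h₁.1, hc ▸ hl⟩),
      List.map_cons, List.map_cons, List.prod_cons, List.prod_cons, ← mul_assoc, ← mul_assoc,
      gen_mul_comm hi hj]

theorem gen_mul_z_of_isDescent {n : ℕ} {w : Equiv.Perm (Fin n)} {i : Fin (n - 1)}
    (h : IsDescent w i) : gen i * z w = z w := by
  obtain ⟨l, hl⟩ := exists_isReducedWord (simpleRefl i * w)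
  rw [z, prod_gen_eq_of_isReducedWord (isReducedWord_reducedWord w)
    (isReducedWord_cons.2 ⟨h, hl⟩), List.map_cons, List.prod_cons, ← mul_assoc, gen_mul_self]

theorem longest_mem {n : ℕ} (J : Set (Fin (n - 1))) : longest J ∈ parabolic J :=
  (Classical.choose_spec (exists_longest J)).1

theorem isDescent_longest {n : ℕ} {J : Set (Fin (n - 1))} {i : Fin (n - 1)} (hi : i ∈ J) :
    IsDescent (longest J) i := by
  by_contra h
  have h1 := (Classical.choose_spec (exists_longest J)).2 (simpleRefl i * longest J)
    (mul_mem (Subgroup.subset_closure (Set.mem_image_of_mem _ hi)) (longest_mem J))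
  rw [← longest, len_eq_invNum, len_eq_invNum, invNum_simpleRefl_mul_of_not_isDescent h] at h1
  omega

theorem gen_mul_idem {n : ℕ} {J : Set (Fin (n - 1))} {i : Fin (n - 1)} (hi : i ∈ J) :
    gen i * idem J = idem J :=
  gen_mul_z_of_isDescent (isDescent_longest hi)

/-- Induction on elements of the `0`-Hecke monoid by multiplying with generators on the left. -/
theorem Hecke.induction_left {n : ℕ} {motive : Hecke n → Prop} (one : motive 1)
    (gen_mul : ∀ i x, motive x → motive (gen i * x)) (x : Hecke n) : motive x := by
  obtain ⟨l, rfl⟩ := PresentedMonoid.surjective_mk x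
  induction l using FreeMonoid.inductionOn' with
  | one => exact one
  | of_mul i l ih => rw [map_mul]; exact gen_mul i _ ih

theorem mul_idem_univ {n : ℕ} (x : Hecke n) : x * idem Set.univ = idem Set.univ := by
  induction x using Hecke.induction_left with
  | one => exact one_mul _
  | gen_mul i x ih => rw [mul_assoc, ih, gen_mul_idem (Set.mem_univ i)]

/-- The anti-automorphism of the `0`-Hecke monoid that reverses words. -/
def Hecke.reverse (n : ℕ) : Hecke n →* (Hecke n)ᵐᵒᵖ :=
  PresentedMonoid.lift (fun i ↦ MulOpposite.op (gen i)) (by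
    rintro _ _ (i | ⟨i, j, hij, hji⟩ | ⟨i, j, hij⟩)
    · simp only [map_mul, FreeMonoid.lift_eval_of, ← MulOpposite.op_mul, gen_mul_self]
    · simp only [map_mul, FreeMonoid.lift_eval_of, ← MulOpposite.op_mul, gen_mul_comm hij hji]
    · simp only [map_mul, FreeMonoid.lift_eval_of, ← MulOpposite.op_mul, ← mul_assoc,
        gen_braid hij])

theorem Hecke.reverse_gen {n : ℕ} (i : Fin (n - 1)) :
    Hecke.reverse n (gen i) = MulOpposite.op (gen i) := rfl

/-- The reversal of `e_0` absorbs everything on the right, so it agrees with `e_0`, which is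
therefore the zero element of the `0`-Hecke monoid. -/
theorem idem_univ_mul {n : ℕ} (x : Hecke n) : idem Set.univ * x = idem Set.univ := by
  set y : Hecke n := (Hecke.reverse n (idem Set.univ)).unop with hy
  have h : ∀ x, y * x = y := by
    intro x
    induction x using Hecke.induction_left with
    | one => exact mul_one _
    | gen_mul i x ih =>
      have : y * gen i = y := by
        rw [hy, ← MulOpposite.unop_op (gen i), ← Hecke.reverse_gen, ← MulOpposite.unop_mul,
          ← map_mul, gen_mul_idem (Set.mem_univ i)]
      rw [← mul_assoc, this, ih]
  have hy' : y = idem Set.univ := by rw [← h (idem Set.univ), mul_idem_univ]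
  rw [← hy', h]

/-- An element fixed by all generators is the zero element. -/
theorem eq_idem_univ {n : ℕ} {x : Hecke n} (h : ∀ i, gen i * x = x) : x = idem Set.univ := by
  have : ∀ y : Hecke n, y * x = x := by
    intro y
    induction y using Hecke.induction_left with
    | one => exact one_mul _
    | gen_mul i y ih => rw [mul_assoc, ih, h]
  rw [← this (idem Set.univ), idem_univ_mul]

/-! ### The two actions on a chain -/

/-- The order-preserving map of the chain that moves `i` up to `i + 1` and fixes all other
points. -/
def upMap {n : ℕ} (i : Fin (n - 1)) : Function.End (Fin n) :=
  fun a ↦ if (a : ℕ) = i then ⟨i + 1, by omega⟩ else a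

/-- The order-preserving map of the chain that moves `i + 1` down to `i` and fixes all other
points. -/
def downMap {n : ℕ} (i : Fin (n - 1)) : Function.End (Fin n) :=
  fun a ↦ if (a : ℕ) = i + 1 then ⟨i, by omega⟩ else a

theorem upMap_val {n : ℕ} (i : Fin (n - 1)) (a : Fin n) :
    (upMap i a : ℕ) = if (a : ℕ) = i then (i : ℕ) + 1 else a := by
  unfold upMap
  split_ifs <;> rfl

theorem downMap_val {n : ℕ} (i : Fin (n - 1)) (a : Fin n) :
    (downMap i a : ℕ) = if (a : ℕ) = i + 1 then (i : ℕ) else a := by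
  unfold downMap
  split_ifs <;> rfl

theorem end_mul_apply {α : Type*} (f g : Function.End α) (a : α) : (f * g) a = f (g a) := rfl

/-- The action of the `0`-Hecke monoid on the chain by `e_i : i ↦ i + 1`. -/
def up (n : ℕ) : Hecke n →* Function.End (Fin n) :=
  PresentedMonoid.lift upMap (by
    rintro _ _ (i | ⟨i, j, hij, hji⟩ | ⟨i, j, hij⟩) <;> funext a <;>
      simp only [map_mul, FreeMonoid.lift_eval_of, end_mul_apply, Fin.ext_iff, upMap_val] <;>
      split_ifs <;> omega)

/-- The action of the `0`-Hecke monoid on the chain by `e_i : i + 1 ↦ i`. -/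
def down (n : ℕ) : Hecke n →* Function.End (Fin n) :=
  PresentedMonoid.lift downMap (by
    rintro _ _ (i | ⟨i, j, hij, hji⟩ | ⟨i, j, hij⟩) <;> funext a <;>
      simp only [map_mul, FreeMonoid.lift_eval_of, end_mul_apply, Fin.ext_iff, downMap_val] <;>
      grind)

theorem up_gen {n : ℕ} (i : Fin (n - 1)) : up n (gen i) = upMap i := rfl

theorem down_gen {n : ℕ} (i : Fin (n - 1)) : down n (gen i) = downMap i := rfl

theorem up_gen_mul {n : ℕ} (i : Fin (n - 1)) (x : Hecke n) (a : Fin n) :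
    up n (gen i * x) a = upMap i (up n x a) := by
  rw [map_mul, end_mul_apply, up_gen]

theorem down_gen_mul {n : ℕ} (i : Fin (n - 1)) (x : Hecke n) (a : Fin n) :
    down n (gen i * x) a = downMap i (down n x a) := by
  rw [map_mul, end_mul_apply, down_gen]

theorem down_le_up {n : ℕ} (x : Hecke n) (a : Fin n) : down n x a ≤ up n x a := by
  induction x using Hecke.induction_left with
  | one => rw [map_one, map_one]
  | gen_mul i x ih =>
    rw [up_gen_mul, down_gen_mul, Fin.le_def, upMap_val, downMap_val]
    rw [Fin.le_def] at ih
    split_ifs <;> omega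

/-- The relation `ξ` relates `a` to `b`. -/
def Relates {n : ℕ} (ξ : SetRel (Fin n) (Fin n)) (a b : Fin n) : Prop := (a, b) ∈ ξ

theorem eq_of_relates_iff {n : ℕ} {ξ η : DC n}
    (h : ∀ a b, Relates (ξ : BinRel n) a b ↔ Relates (η : BinRel n) a b) : ξ = η :=
  Subtype.ext (Set.ext fun ⟨a, b⟩ ↦ h a b)

theorem relates_epsRel {n : ℕ} {i : Fin (n - 1)} {a b : Fin n} :
    Relates (epsRel i) a b ↔ a = b ∨ a = simpleRefl i b := Iff.rfl

/-- The relation spelled by a word in the `ε_i` relates `b` to the points of an interval, whose ends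
are the images of `b` under the two actions on the chain. -/
theorem relates_lift_eps_iff {n : ℕ} (l : FreeMonoid (Fin (n - 1))) (a b : Fin n) :
    Relates (FreeMonoid.lift eps l : DC n).1 a b ↔
      down n (PresentedMonoid.mk _ l) b ≤ a ∧ a ≤ up n (PresentedMonoid.mk _ l) b := by
  induction l using FreeMonoid.inductionOn' generalizing a with
  | one =>
    rw [map_one, map_one, map_one, map_one]
    change a = b ↔ b ≤ a ∧ a ≤ b
    rw [eq_comm, le_antisymm_iff]
  | of_mul i l ih =>
    have h : Relates (FreeMonoid.lift eps (FreeMonoid.of i * l) : DC n).1 a b ↔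
        ∃ t, Relates (epsRel i) a t ∧
          Relates (FreeMonoid.lift eps l : DC n).1 t b := by
      rw [map_mul, FreeMonoid.lift_eval_of]
      rfl
    have hle := down_le_up (PresentedMonoid.mk (HeckeRel n) l) b
    rw [h, map_mul]
    change _ ↔ down n (gen i * _) b ≤ a ∧ a ≤ up n (gen i * _) b
    rw [down_gen_mul, up_gen_mul]
    simp only [ih, relates_epsRel, Fin.le_def, upMap_val, downMap_val]
    rw [Fin.le_def] at hle
    constructor
    · rintro ⟨t, rfl | rfl, h1, h2⟩
      · split_ifs <;> omega
      · rw [simpleRefl_apply]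
        split_ifs <;> omega
    · intro ⟨h1, h2⟩
      by_cases ha : (down n (PresentedMonoid.mk _ l) b : ℕ) ≤ a ∧
          (a : ℕ) ≤ up n (PresentedMonoid.mk _ l) b
      · exact ⟨a, Or.inl rfl, ha⟩
      · refine ⟨simpleRefl i a, Or.inr (Equiv.swap_apply_self _ _ a).symm, ?_⟩
        rw [simpleRefl_apply]
        split_ifs at h1 h2 ⊢ <;> omega

/-- The surjection `e_i ↦ ε_i` of the `0`-Hecke monoid onto the double Catalan monoid. -/
def toDC (n : ℕ) : Hecke n →* DC n :=
  PresentedMonoid.lift eps (by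
    intro l l' h
    refine eq_of_relates_iff fun a b ↦ ?_
    rw [relates_lift_eps_iff, relates_lift_eps_iff, PresentedMonoid.mk_eq_mk_of_rel h])

theorem toDC_gen {n : ℕ} (i : Fin (n - 1)) : toDC n (gen i) = eps i := rfl

theorem relates_toDC_iff {n : ℕ} (x : Hecke n) (a b : Fin n) :
    Relates (toDC n x).1 a b ↔ down n x b ≤ a ∧ a ≤ up n x b := by
  obtain ⟨l, rfl⟩ := PresentedMonoid.surjective_mk x
  exact relates_lift_eps_iff l a b

theorem toDC_surjective {n : ℕ} : Function.Surjective (toDC n) := by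
  rintro ⟨ξ, hξ⟩
  induction hξ using Submonoid.closure_induction with
  | mem ξ h =>
    obtain ⟨i, rfl⟩ := h
    exact ⟨gen i, rfl⟩
  | one => exact ⟨1, map_one _⟩
  | mul ξ η hξ hη h h' =>
    obtain ⟨x, hx⟩ := h
    obtain ⟨y, hy⟩ := h'
    exact ⟨x * y, by rw [map_mul, hx, hy]; rfl⟩

/-- The double Catalan monoid is the image of the `0`-Hecke monoid in the product of its two
actions on the chain. -/
theorem toDC_eq_toDC_iff {n : ℕ} {x y : Hecke n} :
    toDC n x = toDC n y ↔ up n x = up n y ∧ down n x = down n y := by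
  constructor
  · intro h
    have key : ∀ a b, (down n x b ≤ a ∧ a ≤ up n x b) ↔ (down n y b ≤ a ∧ a ≤ up n y b) :=
      fun a b ↦ by rw [← relates_toDC_iff, ← relates_toDC_iff, h]
    exact ⟨funext fun b ↦ le_antisymm ((key _ b).1 ⟨down_le_up x b, le_rfl⟩).2
        ((key _ b).2 ⟨down_le_up y b, le_rfl⟩).2,
      funext fun b ↦ le_antisymm ((key _ b).2 ⟨le_rfl, down_le_up y b⟩).1
        ((key _ b).1 ⟨le_rfl, down_le_up x b⟩).1⟩
  · rintro ⟨h, h'⟩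
    refine eq_of_relates_iff fun a b ↦ ?_
    rw [relates_toDC_iff, relates_toDC_iff, h, h']

/-! ### Points fixed by parabolic idempotents -/

/-- Suppose that every left descent of a permutation fixing `c` fixes `c` as well, which is the case
when `c` is an end of the chain. Then all letters of a reduced word of a permutation `w` fixing `c`
fix `c`, so `z_w` fixes `c` in every action in which the generators `e_i` with `s_i c = c` do. -/
theorem act_z_of_fixed {n : ℕ} (α : Hecke n →* Function.End (Fin n)) (c : Fin n)
    (hα : ∀ i, simpleRefl i c = c → α (gen i) c = c)
    (hc : ∀ i (w : Equiv.Perm (Fin n)), w c = c → IsDescent w i → simpleRefl i c = c)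
    {w : Equiv.Perm (Fin n)} (hw : w c = c) : α (z w) c = c := by
  have key : ∀ (l : List (Fin (n - 1))) (w : Equiv.Perm (Fin n)), w c = c → IsReducedWord w l →
      α (l.map gen).prod c = c := by
    intro l
    induction l with
    | nil => intro w _ _; simp only [List.map_nil, List.prod_nil, map_one]; rfl
    | cons i l ih =>
      intro w hw h
      rw [isReducedWord_cons] at h
      have hi := hc i w hw h.1
      rw [List.map_cons, List.prod_cons, map_mul, end_mul_apply,
        ih _ (by rw [Equiv.Perm.mul_apply, hw, hi]) h.2, hα i hi]
  exact key _ w hw (isReducedWord_reducedWord w)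

theorem fixed_of_mem_parabolic {n : ℕ} {J : Set (Fin (n - 1))} {c : Fin n}
    (hJ : ∀ i ∈ J, simpleRefl i c = c) {w : Equiv.Perm (Fin n)} (hw : w ∈ parabolic J) :
    w c = c := by
  have : parabolic J ≤ MulAction.stabilizer (Equiv.Perm (Fin n)) c := by
    rw [parabolic, Subgroup.closure_le]
    rintro _ ⟨i, hi, rfl⟩
    exact hJ i hi
  exact this hw

theorem inv_apply_of_fixed {n : ℕ} {w : Equiv.Perm (Fin n)} {c : Fin n} (hw : w c = c) :
    w⁻¹ c = c := by
  rw [Equiv.Perm.inv_eq_iff_eq, hw]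

theorem up_idem_compl_first {n : ℕ} (hn : 3 ≤ n) :
    up n (idem {(⟨0, by omega⟩ : Fin (n - 1))}ᶜ) ⟨0, by omega⟩ = ⟨0, by omega⟩ := by
  refine act_z_of_fixed (up n) ⟨0, by omega⟩ (fun i hi ↦ ?_) (fun i w hw hd ↦ ?_)
    (fixed_of_mem_parabolic (fun i hi ↦ ?_) (longest_mem _))
  · rw [Fin.ext_iff, simpleRefl_apply] at hi
    rw [up_gen, Fin.ext_iff, upMap_val]
    simp only at hi ⊢
    split_ifs at hi ⊢ <;> omega
  · by_cases h0 : (i : ℕ) = 0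
    · unfold IsDescent at hd
      have hi : (⟨i, by omega⟩ : Fin n) = ⟨0, by omega⟩ := Fin.ext h0
      rw [hi, inv_apply_of_fixed hw, Fin.lt_def] at hd
      exact absurd hd (Nat.not_lt_zero _)
    · exact simpleRefl_of_ne _ _ (by simp only; omega) (by simp only; omega)
  · have h0 : (i : ℕ) ≠ 0 := fun h ↦ hi (Fin.ext h)
    exact simpleRefl_of_ne _ _ (by simp only; omega) (by simp only; omega)

theorem down_idem_compl_last {n : ℕ} (hn : 3 ≤ n) :
    down n (idem {(⟨n - 2, by omega⟩ : Fin (n - 1))}ᶜ) ⟨n - 1, by omega⟩ = ⟨n - 1, by omega⟩ := by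
  refine act_z_of_fixed (down n) ⟨n - 1, by omega⟩ (fun i hi ↦ ?_) (fun i w hw hd ↦ ?_)
    (fixed_of_mem_parabolic (fun i hi ↦ ?_) (longest_mem _))
  · rw [Fin.ext_iff, simpleRefl_apply] at hi
    rw [down_gen, Fin.ext_iff, downMap_val]
    simp only at hi ⊢
    split_ifs at hi ⊢ <;> omega
  · by_cases h0 : (i : ℕ) = n - 2
    · unfold IsDescent at hd
      have hi : (⟨i + 1, by omega⟩ : Fin n) = ⟨n - 1, by omega⟩ := Fin.ext (by simp only; omega)
      rw [hi, inv_apply_of_fixed hw, Fin.lt_def] at hd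
      simp only at hd
      omega
    · exact simpleRefl_of_ne _ _ (by simp only; omega) (by simp only; omega)
  · have h0 : (i : ℕ) ≠ n - 2 := fun h ↦ hi (Fin.ext h)
    exact simpleRefl_of_ne _ _ (by simp only; omega) (by simp only; omega)

/-! ### Chains in a monoid with Hecke relations -/

/-- Let `d_0, …, d_{m-1}` satisfy the relations of the `0`-Hecke monoid, and let all of them but
`d_0` fix `p_0` from the left. Then left multiplication by `d_i` sends `p_i` to `p_{i+1}` and fixes
the other ones among the elements `p_j = d_{j-1} ⋯ d_0 p_0`. -/
theorem mul_chain {M : Type*} [Monoid M] (m : ℕ) (d : ℕ → M) (p : ℕ → M)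
    (hidem : ∀ i < m, d i * d i = d i)
    (hcomm : ∀ i j, i + 1 < j → j < m → d i * d j = d j * d i)
    (hbraid : ∀ i, i + 1 < m → d i * d (i + 1) * d i = d (i + 1) * d i * d (i + 1))
    (hE : ∀ i, 0 < i → i < m → d i * p 0 = p 0)
    (hp : ∀ j < m, p (j + 1) = d j * p j) {i j : ℕ} (hi : i < m) (hj : j ≤ m) :
    d i * p j = p (if j = i then i + 1 else j) := by
  induction j using Nat.strong_induction_on generalizing i with
  | _ j ih =>
  obtain rfl | ⟨j, rfl⟩ : j = 0 ∨ ∃ k, j = k + 1 := by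
    cases j <;> simp
  · split_ifs with h
    · subst h; exact (hp 0 hi).symm
    · exact hE i (by omega) hi
  · obtain h | h | h | h | h : i = j ∨ i = j + 1 ∨ j + 1 < i ∨ j = i + 1 ∨ i + 1 < j := by omega
    · subst h
      rw [if_neg (by omega), hp i hi, ← mul_assoc, hidem i hi]
    · subst h
      rw [if_pos rfl, hp (j + 1) hi]
    · rw [if_neg (by omega), hp j (by omega), ← mul_assoc, ← hcomm j i h hi, mul_assoc,
        ih j (by omega) hi (by omega), if_neg (by omega)]
    · subst h
      rw [if_neg (by omega), hp (i + 1) (by omega), hp i (by omega), ← mul_assoc, ← mul_assoc,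
        hbraid i (by omega), mul_assoc, ih i (by omega) (by omega) (by omega), if_neg (by omega),
        mul_assoc]
    · rw [if_neg (by omega), hp j (by omega), ← mul_assoc, hcomm i j h (by omega), mul_assoc,
        ih j (by omega) hi (by omega), if_neg (by omega)]

/-! ### Linear independence of two opposite chains -/

section Chains

variable {k V : Type*} [Field k] [AddCommGroup V] [Module k V]

theorem map_sum_smul_sub {m : ℕ} (T : V →ₗ[k] V) (a : Fin m → V) (c : Fin m → k) (i : Fin m)
    (h : ∀ j, j ≠ i → T (a j) = a j) :
    T (∑ j, c j • a j) - ∑ j, c j • a j = c i • (T (a i) - a i) := by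
  rw [map_sum, ← Finset.sum_sub_distrib, Finset.sum_eq_single i]
  · rw [map_smul, smul_sub]
  · intro j _ hj
    rw [map_smul, h j hj, sub_self]
  · exact fun hi ↦ absurd (Finset.mem_univ i) hi

/-- Let the operators `T_0, …, T_{m-1}` move `a_i` up to `a_{i+1}` and `b_{i+1}` down to `b_i`,
where `a_m = 0` and `b_0 = 0`. If neither of the vectors `a_{m-1}` and `b_1`, which span the socles of the
two chains, vanishes, then all the other vectors of the two chains are linearly independent. -/
theorem linearIndependent_chains {m : ℕ} (hm : 2 ≤ m) (T : ℕ → V →ₗ[k] V) (a b : ℕ → V)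
    (ha : ∀ i < m, ∀ j ≤ m, T i (a j) = a (if j = i then i + 1 else j))
    (hb : ∀ i < m, ∀ j ≤ m, T i (b j) = b (if j = i + 1 then i else j))
    (ham : a m = 0) (hb0 : b 0 = 0) (ha' : a (m - 1) ≠ 0) (hb' : b 1 ≠ 0) :
    LinearIndependent k
      (Sum.elim (fun j : Fin m ↦ a j) (fun j : Fin m ↦ b (j + 1))) := by
  have ha0 : ∀ j < m, a j ≠ 0 := by
    intro j hj h
    have : ∀ l, j ≤ l → l < m → a l = 0 := by
      intro l hl
      induction l, hl using Nat.le_induction with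
      | base => exact fun _ ↦ h
      | succ l hl ih =>
        intro hlm
        have := ha l (by omega) l (by omega)
        rw [if_pos rfl, ih (by omega), map_zero] at this
        exact this.symm
    exact ha' (this (m - 1) (by omega) (by omega))
  have hb0' : ∀ j, 0 < j → j ≤ m → b j ≠ 0 := by
    intro j hj
    induction j, hj using Nat.le_induction with
    | base => exact fun _ ↦ hb'
    | succ l hl ih =>
      intro hlm h
      have := hb l (by omega) (l + 1) (by omega)
      rw [if_pos rfl, h, map_zero] at this
      exact ih (by omega) this.symm
  rw [Fintype.linearIndependent_iff]
  intro g hg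
  rw [Fintype.sum_sum_type] at hg
  simp only [Sum.elim_inl, Sum.elim_inr] at hg
  -- apply `T_i - 1` to the linear relation
  have h1 : ∀ i : Fin m, g (.inl i) • (a (i + 1) - a i) + g (.inr i) • (b i - b (i + 1)) = 0 := by
    intro i
    have e1 := map_sum_smul_sub (T i) (fun j : Fin m ↦ a j) (fun j ↦ g (.inl j)) i
      (fun j hj ↦ by rw [ha i i.2 j j.2.le, if_neg (fun h ↦ hj (Fin.ext h))])
    have e2 := map_sum_smul_sub (T i) (fun j : Fin m ↦ b (j + 1)) (fun j ↦ g (.inr j)) i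
      (fun j hj ↦ by
        rw [hb i i.2 (j + 1) j.2, if_neg (fun h ↦ hj (Fin.ext (Nat.succ_injective h)))])
    rw [ha i i.2 i i.2.le, if_pos rfl] at e1
    rw [hb i i.2 (i + 1) i.2, if_pos rfl] at e2
    rw [← e1, ← e2, sub_add_sub_comm, ← map_add, hg, map_zero, sub_zero]
  -- push `a_{i+1}` up to `a_m = 0`
  have h2 : ∀ (i : Fin m) (l : ℕ), (i : ℕ) + 1 ≤ l → l ≤ m →
      g (.inl i) • (a l - a i) + g (.inr i) • (b i - b (i + 1)) = 0 := by
    intro i l hl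
    induction l, hl using Nat.le_induction with
    | base => exact fun _ ↦ h1 i
    | succ l hl ih =>
      intro hlm
      have := congrArg (T l) (ih (by omega))
      rw [map_add, map_smul, map_smul, map_sub, map_sub, map_zero, ha l hlm l (by omega),
        ha l hlm i (by omega), hb l hlm i (by omega), hb l hlm (i + 1) (by omega), if_pos rfl,
        if_neg (by omega), if_neg (by omega), if_neg (by omega)] at this
      exact this
  -- push `b_i` down to `b_0 = 0`
  have h3 : ∀ (i : Fin m) (r : ℕ), r ≤ i →
      g (.inl i) • (a (i + 1) - a i) + g (.inr i) • (b (i - r) - b (i + 1)) = 0 := by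
    intro i r
    induction r with
    | zero => exact fun _ ↦ h1 i
    | succ r ih =>
      intro hr
      have := congrArg (T (i - (r + 1))) (ih (by omega))
      have hlm : (i : ℕ) - (r + 1) < m := by omega
      rw [map_add, map_smul, map_smul, map_sub, map_sub, map_zero, ha _ hlm (i + 1) (by omega),
        ha _ hlm i (by omega), hb _ hlm (i - r) (by omega), hb _ hlm (i + 1) (by omega),
        if_neg (by omega), if_neg (by omega), if_pos (by omega), if_neg (by omega)] at this
      exact this
  have hc : ∀ i : Fin m, (i : ℕ) + 1 < m → g (.inl i) = 0 := by
    intro i hi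
    have e := (h1 i).trans (h2 i m (by omega) le_rfl).symm
    rw [ham, add_left_inj, ← sub_eq_zero, ← smul_sub, sub_sub_sub_cancel_right, sub_zero] at e
    exact (smul_eq_zero.1 e).resolve_right (ha0 _ hi)
  have hd : ∀ i : Fin m, 0 < (i : ℕ) → g (.inr i) = 0 := by
    intro i hi
    have e := (h1 i).trans (h3 i i le_rfl).symm
    rw [Nat.sub_self, hb0, add_right_inj, ← sub_eq_zero, ← smul_sub, sub_sub_sub_cancel_right,
      sub_zero] at e
    exact (smul_eq_zero.1 e).resolve_right (hb0' _ hi i.2.le)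
  rintro (i | i)
  · by_cases hi : (i : ℕ) + 1 < m
    · exact hc i hi
    · have e := h1 i
      have him : (i : ℕ) + 1 = m := by omega
      rw [hd i (by omega), zero_smul, add_zero, him, ham, zero_sub] at e
      exact (smul_eq_zero.1 e).resolve_right (neg_ne_zero.2 (ha0 _ i.2))
  · by_cases hi : 0 < (i : ℕ)
    · exact hd i hi
    · have e := h1 i
      have hi0 : (i : ℕ) = 0 := by omega
      rw [hc i (by omega), zero_smul, zero_add, hi0, hb0, zero_sub] at e
      exact (smul_eq_zero.1 e).resolve_right (neg_ne_zero.2 (hb0' _ (by omega) (by omega)))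

end Chains

/-! ### The two chains in the `0`-Hecke monoid -/

/-- The generator `e_j`, for a natural number `j`; the junk value for `j ≥ n - 1` is `1`. -/
def genNat (n j : ℕ) : Hecke n := if h : j < n - 1 then gen ⟨j, h⟩ else 1

theorem genNat_of_lt {n j : ℕ} (h : j < n - 1) : genNat n j = gen ⟨j, h⟩ := dif_pos h

/-- The element `e_{j-1} ⋯ e_1 e_0 e_{(s)}`, where `s` is the first simple reflection and the
generators are numbered from `0`. For `j < n` these elements form the left ideal generated by
`e_{(s)}`, and the upward action sends the point `0` to `j` under the `j`-th of them. -/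
noncomputable def upChain {n : ℕ} (hn : 3 ≤ n) : ℕ → Hecke n
  | 0 => idem {(⟨0, by omega⟩ : Fin (n - 1))}ᶜ
  | j + 1 => genNat n j * upChain hn j

/-- The element `e_{n-1-r} ⋯ e_{n-2} e_{(s)}`, where `s` is the last simple reflection and the
generators are numbered from `0`. The downward action sends the point `n - 1` to `n - 1 - r` under
this element. -/
noncomputable def downChain {n : ℕ} (hn : 3 ≤ n) : ℕ → Hecke n
  | 0 => idem {(⟨n - 2, by omega⟩ : Fin (n - 1))}ᶜ
  | r + 1 => genNat n (n - 2 - r) * downChain hn r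

section ChainProperties

variable {n : ℕ} (hn : 3 ≤ n)
include hn

theorem genNat_mul_upChain {i j : ℕ} (hi : i < n - 1) (hj : j ≤ n - 1) :
    genNat n i * upChain hn j = upChain hn (if j = i then i + 1 else j) := by
  refine mul_chain (n - 1) (genNat n) (upChain hn) (fun i hi ↦ ?_) (fun i j hij hj ↦ ?_)
    (fun i hi ↦ ?_) (fun i hi hi' ↦ ?_) (fun j _ ↦ rfl) hi hj
  · rw [genNat_of_lt hi, gen_mul_self]
  · rw [genNat_of_lt hj, genNat_of_lt (by omega : i < n - 1)]
    exact gen_mul_comm (by simp only; omega) (by simp only; omega)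
  · rw [genNat_of_lt hi, genNat_of_lt (by omega : i < n - 1)]
    exact gen_braid rfl
  · rw [genNat_of_lt hi']
    exact gen_mul_idem fun h ↦ hi.ne' (Fin.ext_iff.1 h)

theorem genNat_mul_downChain {i r : ℕ} (hi : i < n - 1) (hr : r ≤ n - 1) :
    genNat n i * downChain hn (n - 1 - r) = downChain hn (n - 1 - if r = i + 1 then i else r) := by
  have h := mul_chain (n - 1) (fun i ↦ genNat n (n - 2 - i)) (downChain hn) (fun i hi ↦ ?_)
    (fun i j hij hj ↦ ?_) (fun i hi ↦ ?_) (fun i hi hi' ↦ ?_) (fun j _ ↦ rfl)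
    (by omega : n - 2 - i < n - 1) (by omega : n - 1 - r ≤ n - 1)
  · rw [show n - 2 - (n - 2 - i) = i by omega] at h
    rw [h]
    congr 1
    split_ifs <;> omega
  · rw [genNat_of_lt (by omega : n - 2 - i < n - 1), gen_mul_self]
  · rw [genNat_of_lt (by omega : n - 2 - i < n - 1), genNat_of_lt (by omega : n - 2 - j < n - 1)]
    exact gen_mul_comm (by simp only; omega) (by simp only; omega)
  · rw [genNat_of_lt (by omega : n - 2 - i < n - 1),
      genNat_of_lt (by omega : n - 2 - (i + 1) < n - 1)]
    exact (gen_braid (by simp only; omega)).symm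
  · rw [genNat_of_lt (by omega : n - 2 - i < n - 1)]
    refine gen_mul_idem fun h ↦ ?_
    have := Fin.ext_iff.1 h
    simp only at this
    omega

theorem upChain_last : upChain hn (n - 1) = idem Set.univ := by
  refine eq_idem_univ fun i ↦ ?_
  have h := genNat_mul_upChain hn i.2 le_rfl
  rwa [genNat_of_lt i.2, if_neg (by omega)] at h

theorem downChain_last : downChain hn (n - 1) = idem Set.univ := by
  refine eq_idem_univ fun i ↦ ?_
  have h := genNat_mul_downChain hn i.2 (Nat.zero_le _)
  rwa [genNat_of_lt i.2, if_neg (by omega)] at h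

theorem mul_upChain (x : Hecke n) (j : Fin n) : x * upChain hn j = upChain hn (up n x j) := by
  induction x using Hecke.induction_left with
  | one => rw [one_mul, map_one]; rfl
  | gen_mul i x ih =>
    rw [mul_assoc, ih, up_gen_mul, upMap_val, ← genNat_of_lt i.2,
      genNat_mul_upChain hn i.2 (by omega)]

theorem mul_downChain (x : Hecke n) (j : Fin n) :
    x * downChain hn (n - 1 - j) = downChain hn (n - 1 - down n x j) := by
  induction x using Hecke.induction_left with
  | one => rw [one_mul, map_one]; rfl
  | gen_mul i x ih =>
    rw [mul_assoc, ih, down_gen_mul, downMap_val, ← genNat_of_lt i.2,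
      genNat_mul_downChain hn i.2 (by omega)]

theorem up_upChain {j : ℕ} (hj : j ≤ n - 1) :
    up n (upChain hn j) ⟨0, by omega⟩ = ⟨j, by omega⟩ := by
  induction j with
  | zero => exact up_idem_compl_first hn
  | succ j ih =>
    rw [upChain, genNat_of_lt (by omega : j < n - 1), up_gen_mul, ih (by omega), Fin.ext_iff,
      upMap_val, if_pos rfl]

theorem down_downChain {r : ℕ} (hr : r ≤ n - 1) :
    down n (downChain hn r) ⟨n - 1, by omega⟩ = ⟨n - 1 - r, by omega⟩ := by
  induction r with
  | zero => exact down_idem_compl_last hn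
  | succ r ih =>
    rw [downChain, genNat_of_lt (by omega : n - 2 - r < n - 1), down_gen_mul, ih (by omega),
      Fin.ext_iff, downMap_val, if_pos (by simp only; omega)]
    simp only
    omega

theorem upChain_injOn {i j : ℕ} (hi : i ≤ n - 1) (hj : j ≤ n - 1)
    (h : upChain hn i = upChain hn j) : i = j := by
  have := up_upChain hn hi
  rw [h, up_upChain hn hj] at this
  exact (Fin.ext_iff.1 this).symm

theorem downChain_injOn {i j : ℕ} (hi : i ≤ n - 1) (hj : j ≤ n - 1)
    (h : downChain hn i = downChain hn j) : i = j := by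
  have := down_downChain hn hi
  rw [h, down_downChain hn hj] at this
  have := Fin.ext_iff.1 this
  simp only at this
  omega

theorem toDC_upChain_ne : toDC n (upChain hn (n - 2)) ≠ toDC n (idem Set.univ) := by
  intro h
  rw [toDC_eq_toDC_iff, ← upChain_last hn] at h
  have := congrFun h.1 ⟨0, by omega⟩
  rw [up_upChain hn (by omega), up_upChain hn le_rfl, Fin.ext_iff] at this
  simp only at this
  omega

theorem toDC_downChain_ne : toDC n (downChain hn (n - 2)) ≠ toDC n (idem Set.univ) := by
  intro h
  rw [toDC_eq_toDC_iff, ← downChain_last hn] at h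
  have := congrFun h.2 ⟨n - 1, by omega⟩
  rw [down_downChain hn (by omega), down_downChain hn le_rfl, Fin.ext_iff] at this
  simp only at this
  omega

end ChainProperties

/-! ### The module `P` -/

section Modules

variable (k : Type*) [Field k] {n : ℕ}

/-- The element `x - e_0` of the algebra of the `0`-Hecke monoid. -/
noncomputable def subZero (x : Hecke n) : MonoidAlgebra k (Hecke n) :=
  MonoidAlgebra.of k (Hecke n) x - MonoidAlgebra.of k (Hecke n) (idem Set.univ)

theorem of_mul_subZero (x y : Hecke n) :
    MonoidAlgebra.of k (Hecke n) x * subZero k y = subZero k (x * y) := by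
  rw [subZero, mul_sub, ← map_mul, ← map_mul, mul_idem_univ, subZero]

theorem subZero_injective : Function.Injective (subZero k : Hecke n → _) :=
  fun _ _ h ↦ MonoidAlgebra.of_injective (sub_left_injective h)

theorem subZero_idem_univ : subZero k (idem Set.univ : Hecke n) = 0 := sub_self _

theorem exists_eq_sum_subZero {m : ℕ} (q : ℕ → Hecke n) (hlast : q m = idem Set.univ)
    (hmul : ∀ x, ∃ j ≤ m, x * q 0 = q j) {y : MonoidAlgebra k (Hecke n)}
    (hy : y ∈ Ideal.span {subZero k (q 0)}) :
    ∃ c : Fin m → k, ∑ j, c j • subZero k (q j) = y := by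
  rw [← Submodule.mem_span_range_iff_exists_fun]
  obtain ⟨a, rfl⟩ := Ideal.mem_span_singleton'.1 hy
  clear hy
  induction a using MonoidAlgebra.induction_on with
  | of x =>
    obtain ⟨j, hj, h⟩ := hmul x
    rw [of_mul_subZero, h]
    obtain rfl | hj := hj.eq_or_lt
    · rw [hlast, subZero_idem_univ]
      exact zero_mem _
    · exact Submodule.subset_span ⟨⟨j, hj⟩, rfl⟩
  | add x y hx hy =>
    rw [add_mul]
    exact add_mem hx hy
  | smul r x hx =>
    rw [smul_mul_assoc]
    exact Submodule.smul_mem _ _ hx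

variable (hn : 3 ≤ n)

theorem subZero_upChain_mem (j : ℕ) :
    subZero k (upChain hn j) ∈ P' k (⟨0, by omega⟩ : Fin (n - 1)) := by
  induction j with
  | zero => exact Ideal.mem_span_singleton_self _
  | succ j ih =>
    rw [upChain, ← of_mul_subZero]
    exact Ideal.mul_mem_left _ _ ih

theorem subZero_downChain_mem (r : ℕ) :
    subZero k (downChain hn r) ∈ P' k (⟨n - 2, by omega⟩ : Fin (n - 1)) := by
  induction r with
  | zero => exact Ideal.mem_span_singleton_self _
  | succ j ih =>
    rw [downChain, ← of_mul_subZero]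
    exact Ideal.mul_mem_left _ _ ih

/-- The vectors of the first summand of `P`, indexed by the points of the chain. The last one is
zero. -/
noncomputable def upVec (j : ℕ) : P k n hn := (⟨_, subZero_upChain_mem k hn j⟩, 0)

/-- The vectors of the second summand of `P`, indexed by the points of the chain. The first one is
zero. -/
noncomputable def downVec (j : ℕ) : P k n hn := (0, ⟨_, subZero_downChain_mem k hn (n - 1 - j)⟩)

/-- The action of the `0`-Hecke monoid on `P`. -/
noncomputable def heckeRep : Representation k (Hecke n) (P k n hn) :=
  (Algebra.lsmul k k (P k n hn)).toMonoidHom.comp (MonoidAlgebra.of k (Hecke n))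

theorem heckeRep_apply (x : Hecke n) (p : P k n hn) :
    heckeRep k hn x p = MonoidAlgebra.of k (Hecke n) x • p := rfl

theorem heckeRep_upVec (x : Hecke n) (j : Fin n) :
    heckeRep k hn x (upVec k hn j) = upVec k hn (up n x j) := by
  refine Prod.ext (Subtype.ext ?_) (smul_zero _)
  change MonoidAlgebra.of k (Hecke n) x * subZero k (upChain hn j) = subZero k (upChain hn _)
  rw [of_mul_subZero, mul_upChain]

theorem heckeRep_downVec (x : Hecke n) (j : Fin n) :
    heckeRep k hn x (downVec k hn j) = downVec k hn (down n x j) := by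
  refine Prod.ext (smul_zero _) (Subtype.ext ?_)
  change MonoidAlgebra.of k (Hecke n) x * subZero k (downChain hn (n - 1 - j)) =
    subZero k (downChain hn _)
  rw [of_mul_subZero, mul_downChain]

theorem upVec_injOn {i j : ℕ} (hi : i ≤ n - 1) (hj : j ≤ n - 1)
    (h : upVec k hn i = upVec k hn j) : i = j :=
  upChain_injOn hn hi hj (subZero_injective k (congrArg Subtype.val (congrArg Prod.fst h)))

theorem downVec_injOn {i j : ℕ} (hi : i ≤ n - 1) (hj : j ≤ n - 1)
    (h : downVec k hn i = downVec k hn j) : i = j := by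
  have := downChain_injOn hn (by omega) (by omega)
    (subZero_injective k (congrArg Subtype.val (congrArg Prod.snd h)))
  omega

theorem upVec_last : upVec k hn (n - 1) = 0 := by
  refine Prod.ext (Subtype.ext ?_) rfl
  change subZero k (upChain hn (n - 1)) = 0
  rw [upChain_last, subZero_idem_univ]

theorem downVec_zero : downVec k hn 0 = 0 := by
  refine Prod.ext rfl (Subtype.ext ?_)
  change subZero k (downChain hn (n - 1)) = 0
  rw [downChain_last, subZero_idem_univ]

/-- The `2n - 2` nonzero vectors among the `upVec` and `downVec`. -/
noncomputable def basisVec : Fin (n - 1) ⊕ Fin (n - 1) → P k n hn :=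
  Sum.elim (fun j ↦ upVec k hn j) (fun j ↦ downVec k hn (j + 1))

theorem linearIndependent_basisVec : LinearIndependent k (basisVec k hn) := by
  refine linearIndependent_chains (by omega) (fun i ↦ heckeRep k hn (genNat n i)) (upVec k hn)
    (downVec k hn) (fun i hi j hj ↦ ?_) (fun i hi j hj ↦ ?_) (upVec_last k hn) (downVec_zero k hn)
    (fun h ↦ ?_) (fun h ↦ ?_)
  · have := heckeRep_upVec k hn (genNat n i) ⟨j, by omega⟩
    rwa [genNat_of_lt hi, up_gen, upMap_val, ← genNat_of_lt hi] at this
  · have := heckeRep_downVec k hn (genNat n i) ⟨j, by omega⟩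
    rwa [genNat_of_lt hi, down_gen, downMap_val, ← genNat_of_lt hi] at this
  · rw [← upVec_last k hn] at h
    have := upVec_injOn k hn (by omega) (by omega) h
    omega
  · rw [← downVec_zero k hn] at h
    have := downVec_injOn k hn (by omega) (by omega) h
    omega

theorem span_basisVec : ⊤ ≤ Submodule.span k (Set.range (basisVec k hn)) := by
  rintro ⟨⟨y₁, h₁⟩, ⟨y₂, h₂⟩⟩ -
  obtain ⟨c, hc⟩ := exists_eq_sum_subZero k (m := n - 1) (upChain hn) (upChain_last hn)
    (fun x ↦ ⟨_, by omega, mul_upChain hn x ⟨0, by omega⟩⟩) h₁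
  obtain ⟨d, hd⟩ := exists_eq_sum_subZero k (m := n - 1) (downChain hn) (downChain_last hn)
    (fun x ↦ ⟨n - 1 - down n x ⟨n - 1, by omega⟩, by omega, by
      have := mul_downChain hn x ⟨n - 1, by omega⟩
      simpa only [Nat.sub_self] using this⟩) h₂
  have hsplit : ((⟨y₁, h₁⟩, ⟨y₂, h₂⟩) : P k n hn) =
      ∑ j : Fin (n - 1), c j • upVec k hn j +
        ∑ j : Fin (n - 1), d j • downVec k hn (n - 1 - j) := by
    refine Prod.ext (Subtype.ext ?_) (Subtype.ext ?_)
    · simp only [Prod.fst_add, Prod.fst_sum, Prod.smul_fst, AddSubmonoidClass.coe_finsetSum,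
        Submodule.coe_smul_of_tower, upVec, downVec, smul_zero, Finset.sum_const_zero, add_zero]
      exact hc.symm
    · simp only [Prod.snd_add, Prod.snd_sum, Prod.smul_snd, AddSubmonoidClass.coe_finsetSum,
        Submodule.coe_smul_of_tower, upVec, downVec, smul_zero, Finset.sum_const_zero, zero_add]
      rw [← hd]
      refine Finset.sum_congr rfl fun j _ ↦ ?_
      rw [show n - 1 - (n - 1 - (j : ℕ)) = j by omega]
  rw [hsplit]
  refine add_mem (Submodule.sum_mem _ fun j _ ↦ Submodule.smul_mem _ _ ?_)
    (Submodule.sum_mem _ fun j _ ↦ Submodule.smul_mem _ _ ?_)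
  · exact Submodule.subset_span ⟨.inl j, rfl⟩
  · refine Submodule.subset_span ⟨.inr ⟨n - 2 - j, by omega⟩, ?_⟩
    change downVec k hn (n - 2 - j + 1) = _
    rw [show n - 2 - (j : ℕ) + 1 = n - 1 - j by omega]

/-- The basis of `P` formed by the differences `p - e_0`, where `p ≠ e_0` runs over the elements of
the two chains. -/
noncomputable def basis : Module.Basis (Fin (n - 1) ⊕ Fin (n - 1)) k (P k n hn) :=
  .mk (linearIndependent_basisVec k hn) (span_basisVec k hn)

theorem basis_apply (j : Fin (n - 1) ⊕ Fin (n - 1)) : basis k hn j = basisVec k hn j :=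
  Module.Basis.mk_apply _ _ _

theorem finrank_P : Module.finrank k (P k n hn) = 2 * n - 2 := by
  rw [Module.finrank_eq_card_basis (basis k hn), Fintype.card_sum, Fintype.card_fin]
  omega

theorem heckeRep_eq_iff {x y : Hecke n} :
    heckeRep k hn x = heckeRep k hn y ↔ toDC n x = toDC n y := by
  rw [toDC_eq_toDC_iff]
  constructor
  · intro h
    constructor
    · funext j
      have := heckeRep_upVec k hn x j
      rw [h, heckeRep_upVec] at this
      exact Fin.ext (upVec_injOn k hn (by omega) (by omega) this).symm
    · funext j
      have := heckeRep_downVec k hn x j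
      rw [h, heckeRep_downVec] at this
      exact Fin.ext (downVec_injOn k hn (by omega) (by omega) this).symm
  · rintro ⟨h, h'⟩
    refine (basis k hn).ext ?_
    rintro (j | j)
    · rw [basis_apply]
      change heckeRep k hn x (upVec k hn (⟨j, by omega⟩ : Fin n)) =
        heckeRep k hn y (upVec k hn (⟨j, by omega⟩ : Fin n))
      rw [heckeRep_upVec, heckeRep_upVec, h]
    · rw [basis_apply]
      change heckeRep k hn x (downVec k hn (⟨j + 1, by omega⟩ : Fin n)) =
        heckeRep k hn y (downVec k hn (⟨j + 1, by omega⟩ : Fin n))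
      rw [heckeRep_downVec, heckeRep_downVec, h']

/-- The representation of the double Catalan monoid on `P` through which the action of the
`0`-Hecke monoid factors. -/
noncomputable def dcRep : Representation k (DC n) (P k n hn) where
  toFun ξ := heckeRep k hn (Function.surjInv toDC_surjective ξ)
  map_one' := by
    rw [← map_one (heckeRep k hn), heckeRep_eq_iff, Function.surjInv_eq toDC_surjective, map_one]
  map_mul' ξ η := by
    rw [← map_mul, heckeRep_eq_iff, map_mul, Function.surjInv_eq toDC_surjective,
      Function.surjInv_eq toDC_surjective, Function.surjInv_eq toDC_surjective]

theorem dcRep_toDC (x : Hecke n) : dcRep k hn (toDC n x) = heckeRep k hn x :=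
  (heckeRep_eq_iff k hn).2 (Function.surjInv_eq _ _)

theorem isEffective_dcRep : IsEffective (dcRep k hn) := by
  intro ξ η h
  obtain ⟨x, rfl⟩ := toDC_surjective ξ
  obtain ⟨y, rfl⟩ := toDC_surjective η
  rwa [dcRep_toDC, dcRep_toDC, heckeRep_eq_iff] at h

end Modules

/-! ### Effective representations -/

section Embedding

variable {k : Type*} [Field k] {n : ℕ} {V : Type*} [AddCommGroup V] [Module k V]

/-- Two elements on which an effective representation `σ` differs from `e_0`, namely the elements of
the two chains just before `e_0`, provide vectors on which the socle of `P` does not vanish, and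
evaluation at these vectors embeds `P`. -/
theorem embedsIn_of_isEffective (hn : 3 ≤ n) {σ : Representation k (DC n) V}
    (hσ : IsEffective σ) : EmbedsIn (dcRep k hn) σ := by
  have exists_ne : ∀ {x : Hecke n}, toDC n x ≠ toDC n (idem Set.univ) →
      ∃ v, σ (toDC n x) v - σ (toDC n (idem Set.univ)) v ≠ 0 := by
    intro x hx
    by_contra! h
    exact hx (hσ (LinearMap.ext fun v ↦ sub_eq_zero.1 (h v)))
  obtain ⟨v₁, hv₁⟩ := exists_ne (toDC_upChain_ne hn)
  obtain ⟨v₂, hv₂⟩ := exists_ne (toDC_downChain_ne hn)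
  let σH : Representation k (Hecke n) V := σ.comp (toDC n)
  let φ : MonoidAlgebra k (Hecke n) →ₐ[k] Module.End k V := σH.asAlgebraHom
  have hφ : ∀ x, φ (MonoidAlgebra.of k (Hecke n) x) = σ (toDC n x) := fun x ↦
    Representation.asAlgebraHom_of σH x
  have hφ0 : ∀ x v, φ (subZero k x) v = σ (toDC n x) v - σ (toDC n (idem Set.univ)) v := by
    intro x v
    rw [subZero, map_sub, hφ, hφ, LinearMap.sub_apply]
  let F : P k n hn →ₗ[k] V :=
    { toFun := fun p ↦ φ p.1.1 v₁ + φ p.2.1 v₂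
      map_add' := fun p q ↦ by
        simp only [Prod.fst_add, Prod.snd_add, Submodule.coe_add, map_add, LinearMap.add_apply]
        abel
      map_smul' := fun c p ↦ by
        simp only [Prod.smul_fst, Prod.smul_snd, Submodule.coe_smul_of_tower, map_smul,
          LinearMap.smul_apply, smul_add, RingHom.id_apply] }
  have hF : ∀ x p, F (heckeRep k hn x p) = σ (toDC n x) (F p) := by
    intro x p
    change φ (MonoidAlgebra.of k (Hecke n) x * p.1.1) v₁ +
      φ (MonoidAlgebra.of k (Hecke n) x * p.2.1) v₂ = σ (toDC n x) (φ p.1.1 v₁ + φ p.2.1 v₂)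
    rw [map_mul, map_mul, hφ, map_add]
    rfl
  have hup : ∀ j, F (upVec k hn j) = φ (subZero k (upChain hn j)) v₁ := by
    intro j
    change _ + φ 0 v₂ = _
    rw [map_zero, LinearMap.zero_apply, add_zero]
    rfl
  have hdown : ∀ j, F (downVec k hn j) = φ (subZero k (downChain hn (n - 1 - j))) v₂ := by
    intro j
    change φ 0 v₁ + _ = _
    rw [map_zero, LinearMap.zero_apply, zero_add]
    rfl
  have hli : LinearIndependent k (F ∘ basis k hn) := by
    have h : F ∘ basis k hn = Sum.elim (fun j : Fin (n - 1) ↦ F (upVec k hn j))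
        (fun j : Fin (n - 1) ↦ F (downVec k hn (j + 1))) := by
      funext j
      rw [Function.comp_apply, basis_apply]
      cases j <;> rfl
    rw [h]
    refine linearIndependent_chains (by omega) (fun i ↦ σ (toDC n (genNat n i)))
      (fun j ↦ F (upVec k hn j)) (fun j ↦ F (downVec k hn j)) (fun i hi j hj ↦ ?_)
      (fun i hi j hj ↦ ?_) ?_ ?_ ?_ ?_
    · have := heckeRep_upVec k hn (genNat n i) ⟨j, by omega⟩
      rw [genNat_of_lt hi, up_gen, upMap_val, ← genNat_of_lt hi] at this
      rw [← hF, this]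
    · have := heckeRep_downVec k hn (genNat n i) ⟨j, by omega⟩
      rw [genNat_of_lt hi, down_gen, downMap_val, ← genNat_of_lt hi] at this
      rw [← hF, this]
    · rw [upVec_last, map_zero]
    · rw [downVec_zero, map_zero]
    · rw [hup, hφ0, Nat.sub_sub]
      exact hv₁
    · rw [hdown, hφ0, Nat.sub_sub]
      exact hv₂
  refine ⟨F.intertwiningMap_of_isIntertwiningMap _ _ fun ξ p ↦ ?_, ?_⟩
  · obtain ⟨x, rfl⟩ := toDC_surjective ξ
    rw [dcRep_toDC, hF]
  · have := (basis k hn).injective_constr_of_linearIndependent (R₂ := k) hli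
    rwa [show F ∘ basis k hn = fun i ↦ F (basis k hn i) from rfl, Module.Basis.constr_self] at this

theorem finrank_le_of_isEffective [Module.Finite k V] (hn : 3 ≤ n)
    {σ : Representation k (DC n) V} (hσ : IsEffective σ) : 2 * n - 2 ≤ Module.finrank k V := by
  obtain ⟨f, hf⟩ := embedsIn_of_isEffective hn hσ
  rw [← finrank_P k hn]
  exact LinearMap.finrank_le_finrank_of_injective (f := f.toLinearMap) hf

instance finite_P (hn : 3 ≤ n) : Module.Finite k (P k n hn) :=
  Module.Finite.of_basis (basis k hn)

theorem isMinimalEffective_dcRep (hn : 3 ≤ n) : IsMinimalEffective (dcRep k hn) := by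
  refine ⟨isEffective_dcRep k hn, fun U hU ↦ ?_⟩
  have h := finrank_le_of_isEffective hn hU
  rw [← finrank_P k hn] at h
  exact Subrepresentation.toSubmodule_injective
    (Submodule.eq_top_of_finrank_eq (le_antisymm (Submodule.finrank_le _) h))

theorem isEffective_range {M W : Type*} [Monoid M] [AddCommGroup W] [Module k W]
    {ρ : Representation k M V} {σ : Representation k M W} (f : ρ.IntertwiningMap σ)
    (hf : Function.Injective f) (hρ : IsEffective ρ) : IsEffective f.range.toRepresentation := by
  intro g h hgh
  refine hρ (LinearMap.ext fun v ↦ hf ?_)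
  rw [f.isIntertwining, f.isIntertwining]
  exact congrArg Subtype.val (LinearMap.congr_fun hgh ⟨f v, v, rfl⟩)

theorem isLeast_dim_isEffective (k : Type*) [Field k] (hn : 3 ≤ n) :
    IsLeast {d : ℕ | ∃ ρ : Representation k (DC n) (Fin d → k), IsEffective ρ} (2 * n - 2) := by
  constructor
  · let e := (Module.finBasisOfFinrankEq k (P k n hn) (finrank_P k hn)).equivFun
    exact ⟨(e.conjRingEquiv.toMulEquiv : _ ≃* _).toMonoidHom.comp (dcRep k hn),
      e.conjRingEquiv.injective.comp (isEffective_dcRep k hn)⟩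
  · rintro d ⟨σ, hσ⟩
    simpa using finrank_le_of_isEffective hn hσ

end Embedding

end DoubleCatalan

theorem mainTheorem2 (k : Type u) [Field k] (n : ℕ) (hn : 3 ≤ n) :
    -- the minimal dimension of an effective representation is `2n - 2`
    IsLeast {d : ℕ | ∃ ρ : Representation k (DoubleCatalan.DC n) (Fin d → k),
      DoubleCatalan.IsEffective ρ} (2 * n - 2) ∧
    -- the action of the `0`-Hecke monoid on `P` makes `P` a module over `DC_n`
    ∃ ρ : Representation k (DoubleCatalan.DC n) (DoubleCatalan.P k n hn),
      (∀ (i : Fin (n - 1)) (x : DoubleCatalan.P k n hn),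
        ρ (DoubleCatalan.eps i) x =
          MonoidAlgebra.of k (DoubleCatalan.Hecke n) (DoubleCatalan.gen i) • x) ∧
      Module.finrank k (DoubleCatalan.P k n hn) = 2 * n - 2 ∧
      -- `P` is a minimal effective module, and embeds in every effective module
      DoubleCatalan.IsMinimalEffective ρ ∧
      (∀ (V : Type v) [AddCommGroup V] [Module k V] (σ : Representation k (DoubleCatalan.DC n) V),
        DoubleCatalan.IsEffective σ → DoubleCatalan.EmbedsIn ρ σ) ∧
      -- every minimal effective module is isomorphic to `P`
      (∀ (V : Type v) [AddCommGroup V] [Module k V] (σ : Representation k (DoubleCatalan.DC n) V),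
        DoubleCatalan.IsMinimalEffective σ → Nonempty (ρ.Equiv σ)) ∧
      -- every effective module that embeds in all effective modules is isomorphic to `P`
      (∀ (V : Type v) [AddCommGroup V] [Module k V] (σ : Representation k (DoubleCatalan.DC n) V),
        DoubleCatalan.IsEffective σ →
        (∀ (V' : Type u) [AddCommGroup V'] [Module k V']
          (τ : Representation k (DoubleCatalan.DC n) V'),
          DoubleCatalan.IsEffective τ → DoubleCatalan.EmbedsIn σ τ) →
        Nonempty (ρ.Equiv σ)) := by
  open DoubleCatalan in
  refine ⟨isLeast_dim_isEffective k hn, dcRep k hn, fun i x ↦ ?_, finrank_P k hn,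
    isMinimalEffective_dcRep hn, fun V _ _ σ hσ ↦ embedsIn_of_isEffective hn hσ,
    fun V _ _ σ hσ ↦ ?_, fun V _ _ σ hσ h ↦ ?_⟩
  · rw [← toDC_gen, dcRep_toDC, heckeRep_apply]
  · obtain ⟨f, hf⟩ := embedsIn_of_isEffective hn hσ.1
    have htop := hσ.2 f.range (isEffective_range f hf (isEffective_dcRep k hn))
    have hsurj : Function.Surjective f := fun w ↦ by
      have hw : w ∈ (⊤ : Subrepresentation σ) := Submodule.mem_top
      rwa [← htop] at hw
    exact ⟨f.ofBijective ⟨hf, hsurj⟩⟩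
  · obtain ⟨f, hf⟩ := embedsIn_of_isEffective hn hσ
    obtain ⟨g, hg⟩ := h _ (dcRep k hn) (isEffective_dcRep k hn)
    have : Module.Finite k V := Module.Finite.of_injective g.toLinearMap hg
    have hdim : Module.finrank k (P k n hn) = Module.finrank k V :=
      le_antisymm (LinearMap.finrank_le_finrank_of_injective (f := f.toLinearMap) hf)
        (LinearMap.finrank_le_finrank_of_injective (f := g.toLinearMap) hg)
    exact ⟨f.ofBijective ⟨hf, (LinearMap.injective_iff_surjective_of_finrank_eq_finrank
      (f := f.toLinearMap) hdim).1 hf⟩⟩
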